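/- Conventions. For real matrices $S_1\in\mathbb R^{m_1\times n_1}$ and $S_2\in\mathbb R^{m_2\times n_2}$ with at least one row and one column each, the \emph{1-product} $S_1\otimes S_2$ is the $(m_1+m_2)\times(n_1n_2)$ matrix whose columns are all the concatenations of a column of $S_1$ with a column of $S_2$. The \emph{base polytope} $B(M)\subseteq\mathbb R^E$ of a matroid $M$ on a finite ground set $E$ is the convex hull of the characteristic vectors of the bases of $M$. A matrix $S$ is a \emph{slack matrix} of a polytope $P$ if there are points $v_j$ with $P=\mathrm{conv}\{v_j\}_j$ and linear inequalities $a_i^\top x\le b_i$ with $P=\{x\in\mathrm{aff}(P): a_i^\top x\le b_i \text{ for all } i\}$ such that $S_{i,j}=b_i-a_i^\top v_j$ (equations defining the affine hull of $P$ do not appear as rows). For matroids $M_1,M_2$ on disjoint non-empty ground sets $E_1, E_2$, the \emph{1-sum} $M_1\oplus M_2$ is the matroid on $E_1\cup E_2$ whose bases are the sets $B_1\cup B_2$ with $B_i$ a basis of $M_i$. Call a slack matrix $S$ of $B(M)$ (with respect to points $v_j$) \emph{normalized} if (1) $M$ has no loops and no coloops; (2) no row of $S$ is constant; (3) for each $e\in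 E$, $S$ has a row for the inequality $x(e)\ge 0$, i.e. a row $i$ with $S_{i,j}=v_j(e)$ for all $j$. \textbf{Lemma.} Let $M$ be a matroid on a finite ground set and let $S$ be a normalized slack matrix of $B(M)$. If $S=S_1\otimes S_2$, up to permuting rows and columns, for some non-empty matrices $S_1,S_2$, then there are matroids $M_1,M_2$ with disjoint non-empty ground sets such that $M=M_1\oplus M_2$ and, for $i=1,2$, $S_i$ is a slack matrix of $B(M_i)$, and indeed a normalized one. -/

import Mathlib

/-- The 1-product `S₁ ⊗ S₂`: its rows are the rows of `S₁` followed by the rows of `S₂`, and its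
columns are all concatenations of a column of `S₁` with a column of `S₂`. -/
def oneProduct {R₁ R₂ J₁ J₂ : Type*} (S₁ : Matrix R₁ J₁ ℝ) (S₂ : Matrix R₂ J₂ ℝ) :
    Matrix (R₁ ⊕ R₂) (J₁ × J₂) ℝ :=
  Matrix.of fun i j => Sum.elim (fun i₁ => S₁ i₁ j.1) (fun i₂ => S₂ i₂ j.2) i

/-- Two matrices are isomorphic if one arises from the other by permuting (relabelling) rows and
columns. -/
def MatrixIsomorphic {R J R' J' : Type*} (S : Matrix R J ℝ) (S' : Matrix R' J' ℝ) : Prop :=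
  ∃ (r : R ≃ R') (c : J ≃ J'), S.reindex r c = S'

/-- `S` is the slack matrix of `P` with respect to the points `v j` and the inequalities
`a i x ≤ b i`: `P` is the convex hull of the points, `P` is described, inside its affine hull, by
the inequalities, and `S i j` is the slack of the point `v j` in the inequality `i`.
The equations that cut out the affine hull of `P` do not contribute rows to `S`; when `P` is
full-dimensional its affine hull is the whole space. -/
structure IsSlackMatrixWith {V R J : Type*} [AddCommGroup V] [Module ℝ V]
    (P : Set V) (v : J → V) (a : R → Module.Dual ℝ V) (b : R → ℝ) (S : Matrix R J ℝ) : Prop where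
  eq_convexHull : P = convexHull ℝ (Set.range v)
  eq_inequalities : P = {x | x ∈ affineSpan ℝ P ∧ ∀ i, a i x ≤ b i}
  slack_eq : ∀ i j, S i j = b i - a i (v j)

/-- `S` is a slack matrix of `P`. -/
def IsSlackMatrix {V R J : Type*} [AddCommGroup V] [Module ℝ V]
    (P : Set V) (S : Matrix R J ℝ) : Prop :=
  ∃ (v : J → V) (a : R → Module.Dual ℝ V) (b : R → ℝ), IsSlackMatrixWith P v a b S

namespace Matroid

/-- The characteristic vector in `ℝ^E` of a subset `B` of the ground set `E`. -/
noncomputable def charVec {α : Type*} (M : Matroid α) (B : Set α) : M.E → ℝ :=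
  Set.indicator {e : M.E | (e : α) ∈ B} 1

/-- The base polytope `B(M)` in `ℝ^E`: the convex hull of the characteristic vectors of bases. -/
noncomputable def basePolytope {α : Type*} (M : Matroid α) : Set (M.E → ℝ) :=
  convexHull ℝ {x | ∃ B, M.IsBase B ∧ x = M.charVec B}

/-- `S` is a slack matrix of the base polytope of `M`, with the standing assumptions: `M` has no
loops and no coloops, no row of `S` is constant, and `S` has a row for each inequality
`x(e) ≥ 0`, where `e` is an element of `M`. -/
def IsNormalizedSlackMatrix {α R J : Type*} (M : Matroid α) (S : Matrix R J ℝ) : Prop :=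
  (∀ e, ¬ M.IsLoop e) ∧ (∀ e, ¬ M.IsColoop e) ∧
  (∀ i, ¬ ∃ c : ℝ, ∀ j, S i j = c) ∧
  ∃ (v : J → M.E → ℝ) (a : R → Module.Dual ℝ (M.E → ℝ)) (b : R → ℝ),
    IsSlackMatrixWith M.basePolytope v a b S ∧
    ∀ e : M.E, ∃ i, ∀ j, S i j = v j e

end Matroid

open Set

/-! Every coordinate `x(e)` of the points occurs as a row of `S₁ ⊗ S₂`. If that row comes from `S₁`,
the coordinate depends only on the first column index; if from `S₂`, only on the second. Let `X` be
the set of elements of the first kind. The points form a product, so the polytope is closed under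
taking the coordinates in `X` from one point and the others from another (`ite_mem_basePolytope`).
Its 0/1 points are exactly the bases, so `B ∩ X ∪ B' \ X` is a base for all bases `B`, `B'`, which
splits `M` as the sum of its restrictions to `X` and to the complement.

For the slack matrices (`IsSlackMatrixWith.of_oneProduct`), fix a column of `S₂`: its points span a
slice of the polytope that projects onto the base polytope of `M ↾ X`. The `S₂`-rows are constant on
this slice, so the `S₁`-rows alone describe it. -/

/-- Relabelling the rows and columns of a slack matrix. -/
theorem IsSlackMatrixWith.relabel {V R J R' J' : Type*} [AddCommGroup V] [Module ℝ V]
    {P : Set V} {v : J → V} {a : R → Module.Dual ℝ V} {b : R → ℝ} {S : Matrix R J ℝ}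
    {S' : Matrix R' J' ℝ} (h : IsSlackMatrixWith P v a b S) (r : R' ≃ R) (c : J' ≃ J)
    (hS : ∀ i j, S' i j = S (r i) (c j)) :
    IsSlackMatrixWith P (v ∘ c) (a ∘ r) (b ∘ r) S' where
  eq_convexHull := by rw [c.surjective.range_comp]; exact h.eq_convexHull
  eq_inequalities :=
    h.eq_inequalities.trans (Set.ext fun _ => and_congr_right fun _ => r.surjective.forall)
  slack_eq i j := by simp [hS, h.slack_eq]

/-- If `S₁ ⊗ S₂` is a slack matrix of `P`, and the projection `π` has an affine section `f` whose
image contains the points labelled by a fixed column `j₂` of `S₂`, while `π` forgets the column of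
`S₂`, then `S₁` is a slack matrix of `π '' P`. -/
theorem IsSlackMatrixWith.of_oneProduct {V W R₁ R₂ J₁ J₂ : Type*}
    [AddCommGroup V] [Module ℝ V] [AddCommGroup W] [Module ℝ W]
    {S₁ : Matrix R₁ J₁ ℝ} {S₂ : Matrix R₂ J₂ ℝ} {P : Set V} {v : J₁ × J₂ → V}
    {a : R₁ ⊕ R₂ → Module.Dual ℝ V} {b : R₁ ⊕ R₂ → ℝ}
    (h : IsSlackMatrixWith P v a b (oneProduct S₁ S₂))
    (π : V →ₗ[ℝ] W) (f : W →ᵃ[ℝ] V) (hf : ∀ x, π (f x) = x) (j₂ : J₂)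
    (hfv : ∀ j₁, f (π (v (j₁, j₂))) = v (j₁, j₂))
    (hv : ∀ j₁ j₂', π (v (j₁, j₂')) = π (v (j₁, j₂))) :
    IsSlackMatrixWith (π '' P) (fun j₁ => π (v (j₁, j₂)))
      (fun i => a (Sum.inl i) ∘ₗ f.linear) (fun i => b (Sum.inl i) - a (Sum.inl i) (f 0)) S₁ := by
  have hlin : ∀ x, f x = f.linear x + f 0 := fun x => congrFun f.decomp x
  have hmem : ∀ j, v j ∈ P := fun j => by
    rw [h.eq_convexHull]; exact subset_convexHull ℝ _ (mem_range_self j)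
  have hconv : π '' P = convexHull ℝ (range fun j₁ => π (v (j₁, j₂))) := by
    rw [h.eq_convexHull, π.image_convexHull]
    congr 1
    ext x
    constructor
    · rintro ⟨_, ⟨⟨j, j'⟩, rfl⟩, rfl⟩
      exact ⟨j, (hv j j').symm⟩
    · rintro ⟨j, rfl⟩
      exact ⟨_, ⟨(j, j₂), rfl⟩, rfl⟩
  refine ⟨hconv, ?_, fun i j => ?_⟩
  · refine Subset.antisymm ?_ ?_
    · refine fun x hx => ⟨subset_affineSpan ℝ _ hx, fun i => ?_⟩
      have hhalf : Convex ℝ {x | (a (Sum.inl i) ∘ₗ f.linear) x ≤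
          b (Sum.inl i) - a (Sum.inl i) (f 0)} :=
        convex_halfSpace_le (LinearMap.isLinear _) _
      rw [hconv] at hx
      refine convexHull_min ?_ hhalf hx
      rintro _ ⟨j, rfl⟩
      have hle := (h.eq_inequalities.subset (hmem (j, j₂))).2 (Sum.inl i)
      rw [← hfv, hlin, map_add] at hle
      simpa using le_sub_iff_add_le.2 hle
    · rintro x ⟨hx, hle⟩
      rw [hconv, affineSpan_convexHull] at hx
      refine ⟨f x, ?_, hf x⟩
      rw [h.eq_inequalities]
      refine ⟨?_, ?_⟩
      · have : affineSpan ℝ (range fun j₁ => π (v (j₁, j₂))) ≤ (affineSpan ℝ P).comap f := by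
          rw [affineSpan_le]
          rintro _ ⟨j, rfl⟩
          simpa [hfv] using subset_affineSpan ℝ _ (hmem (j, j₂))
        exact this hx
      · rintro (i | i)
        · have := hle i
          rw [hlin, map_add]
          simpa using le_sub_iff_add_le.1 this
        -- The `S₂`-rows do not see `j₁`, so they are constant on the affine span of the slice and
        -- hold at `f x` because they hold at a vertex.
        · have hs : ∀ j₁, a (Sum.inr i) (v (j₁, j₂)) = b (Sum.inr i) - S₂ i j₂ := fun j₁ => by
            have := h.slack_eq (Sum.inr i) (j₁, j₂)
            simp only [oneProduct, Matrix.of_apply, Sum.elim_inr] at this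
            linarith
          have hx' : a (Sum.inr i) (f x) = b (Sum.inr i) - S₂ i j₂ := by
            clear hle
            induction hx using affineSpan_induction' with
            | mem y hy =>
              obtain ⟨j, rfl⟩ := hy
              simp only [hfv, hs]
            | smul_vsub_vadd c u _ v' _ w _ hu hv' hw =>
              rw [hlin, map_add] at hu hv' hw ⊢
              simp only [vsub_eq_sub, vadd_eq_add, map_add, map_smul, map_sub, smul_eq_mul]
              linear_combination c * hu - c * hv' + hw
          obtain ⟨j₁⟩ : Nonempty J₁ := by
            by_contra hJ
            rw [not_nonempty_iff] at hJ
            rw [range_eq_empty, AffineSubspace.span_empty] at hx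
            exact hx
          have := (h.eq_inequalities.subset (hmem (j₁, j₂))).2 (Sum.inr i)
          rw [hx', ← hs j₁]
          exact this
  · have := h.slack_eq (Sum.inl i) (j, j₂)
    simp only [oneProduct, Matrix.of_apply, Sum.elim_inl] at this
    rw [this, ← hfv, hlin, map_add, ← hlin, hfv]
    simp only [LinearMap.comp_apply]
    ring

namespace Matroid

variable {α : Type*}

@[simp] theorem charVec_apply_of_mem {M : Matroid α} {B : Set α} {e : M.E} (he : (e : α) ∈ B) :
    M.charVec B e = 1 := by
  simp [charVec, he]

@[simp] theorem charVec_apply_of_notMem {M : Matroid α} {B : Set α} {e : M.E}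
    (he : (e : α) ∉ B) : M.charVec B e = 0 := by
  simp [charVec, he]

theorem charVec_injOn (M : Matroid α) : InjOn M.charVec {B | B ⊆ M.E} := by
  have key : ∀ B B' : Set α, B ⊆ M.E → M.charVec B = M.charVec B' → B ⊆ B' := by
    intro B B' hB h e he
    by_contra he'
    have := congrFun h ⟨e, hB he⟩
    rw [charVec_apply_of_mem he, charVec_apply_of_notMem he'] at this
    exact one_ne_zero this
  exact fun B hB B' hB' h => (key B B' hB h).antisymm (key B' B hB' h.symm)

theorem IsBase.charVec_mem_basePolytope {M : Matroid α} {B : Set α} (hB : M.IsBase B) :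
    M.charVec B ∈ M.basePolytope :=
  subset_convexHull ℝ _ ⟨B, hB, rfl⟩

/-- The only `0/1`-vectors in the base polytope are the characteristic vectors of bases. -/
theorem isBase_of_charVec_mem_basePolytope {M : Matroid α} {B : Set α} (hB : B ⊆ M.E)
    (h : M.charVec B ∈ M.basePolytope) : M.IsBase B := by
  have hcube : ∀ A : Set α, M.charVec A ∈ univ.pi fun _ : M.E => ({0, 1} : Set ℝ) := by
    intro A e _
    by_cases he : (e : α) ∈ A <;> simp [he]
  -- A 0/1-vector is extreme in the cube, hence in the smaller polytope; extreme points of a hull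
  -- are among its generators.
  have hext : M.charVec B ∈ M.basePolytope.extremePoints ℝ := by
    refine inter_extremePoints_subset_extremePoints_of_subset
      (A := univ.pi fun _ : M.E => Icc (0 : ℝ) 1) ?_ ⟨h, ?_⟩
    · refine convexHull_min ?_ (convex_pi fun _ _ => convex_Icc 0 1)
      rintro _ ⟨A, -, rfl⟩
      refine fun e he => ?_
      rcases hcube A e he with h' | h' <;> rw [h'] <;> simp
    · rw [extremePoints_pi]
      simpa only [Set.extremePoints_Icc zero_le_one] using hcube B
  obtain ⟨B', hB', hBB'⟩ := extremePoints_convexHull_subset hext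
  rwa [M.charVec_injOn hB hB'.subset_ground hBB']

/-! ### Direct sums from base exchange -/

/-- If bases can be exchanged along `X`, then every base restricts to a base of `M ↾ X`. -/
theorem IsBase.inter_isBase_restrict {M : Matroid α} {X B : Set α} (hB : M.IsBase B)
    (hX : ∀ B B', M.IsBase B → M.IsBase B' → M.IsBase (B ∩ X ∪ B' \ X)) :
    (M ↾ X).IsBase (B ∩ X) := by
  obtain ⟨I, hI, hBI⟩ := (show (M ↾ X).Indep (B ∩ X) from
    restrict_indep_iff.2 ⟨hB.indep.inter_right X, inter_subset_right⟩).exists_isBase_superset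
  obtain ⟨hIi, hIX⟩ := restrict_indep_iff.1 hI.indep
  obtain ⟨B', hB', hIB'⟩ := hIi.exists_isBase_superset
  -- The exchanged base contains `B`, hence equals it, which forces `B' ∩ X ⊆ B`.
  have heq : B = B' ∩ X ∪ B \ X := by
    refine hB.eq_of_subset_isBase (hX B' B hB' hB) fun e he => ?_
    by_cases heX : e ∈ X
    · exact Or.inl ⟨hIB' (hBI ⟨he, heX⟩), heX⟩
    · exact Or.inr ⟨he, heX⟩
  have hIB : I ⊆ B ∩ X := fun e he =>
    ⟨heq.symm.subset (Or.inl ⟨hIB' he, hIX he⟩), hIX he⟩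
  rwa [hBI.antisymm hIB]

theorem exists_isBase_inter_eq {M : Matroid α} {X I : Set α} (hI : (M ↾ X).IsBase I) :
    ∃ B, M.IsBase B ∧ B ∩ X = I := by
  obtain ⟨hIi, hIX⟩ := restrict_indep_iff.1 hI.indep
  obtain ⟨B, hB, hIB⟩ := hIi.exists_isBase_superset
  refine ⟨B, hB, (hI.eq_of_subset_indep ?_ (subset_inter hIB hIX)).symm⟩
  exact restrict_indep_iff.2 ⟨hB.indep.inter_right X, inter_subset_right⟩

theorem exchange_compl {M : Matroid α} {X : Set α}
    (hX : ∀ B B', M.IsBase B → M.IsBase B' → M.IsBase (B ∩ X ∪ B' \ X))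
    (B B' : Set α) (hB : M.IsBase B) (hB' : M.IsBase B') :
    M.IsBase (B ∩ (M.E \ X) ∪ B' \ (M.E \ X)) := by
  have := hX B' B hB' hB
  have h1 := hB.subset_ground
  have h2 := hB'.subset_ground
  clear hX
  convert this using 1
  ext e
  have h3 : e ∈ B → e ∈ M.E := fun h => h1 h
  have h4 : e ∈ B' → e ∈ M.E := fun h => h2 h
  simp only [mem_union, mem_inter_iff, mem_sdiff]
  tauto

theorem IsRestriction.isBase_inter {M N : Matroid α} (hN : N ≤r M) {B : Set α}
    (hX : ∀ B B', M.IsBase B → M.IsBase B' → M.IsBase (B ∩ N.E ∪ B' \ N.E)) (hB : M.IsBase B) :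
    N.IsBase (B ∩ N.E) := by
  have := hB.inter_isBase_restrict hX
  rwa [hN.eq_restrict] at this

theorem IsRestriction.exists_isBase_inter_eq {M N : Matroid α} (hN : N ≤r M) {I : Set α}
    (hI : N.IsBase I) : ∃ B, M.IsBase B ∧ B ∩ N.E = I := by
  rw [← hN.eq_restrict] at hI
  exact Matroid.exists_isBase_inter_eq hI

theorem eq_disjointSum_of_isRestriction {M M₁ M₂ : Matroid α} (h₁ : M₁ ≤r M) (h₂ : M₂ ≤r M)
    (hdisj : Disjoint M₁.E M₂.E) (hE : M₂.E = M.E \ M₁.E)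
    (hX : ∀ B B', M.IsBase B → M.IsBase B' → M.IsBase (B ∩ M₁.E ∪ B' \ M₁.E)) :
    M = M₁.disjointSum M₂ hdisj := by
  have hX₂ : ∀ B B', M.IsBase B → M.IsBase B' → M.IsBase (B ∩ M₂.E ∪ B' \ M₂.E) := by
    rw [hE]; exact exchange_compl hX
  have hunion : M₁.E ∪ M₂.E = M.E := by rw [hE, union_sdiff_cancel h₁.subset]
  refine ext_isBase (by rw [disjointSum_ground_eq, hunion]) fun B hBE => ?_
  rw [disjointSum_isBase_iff]
  constructor
  · intro hB
    exact ⟨h₁.isBase_inter hX hB, h₂.isBase_inter hX₂ hB, hunion.symm ▸ hBE⟩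
  · rintro ⟨hB₁, hB₂, -⟩
    obtain ⟨B₁, hB₁, hBB₁⟩ := h₁.exists_isBase_inter_eq hB₁
    obtain ⟨B₂, hB₂, hBB₂⟩ := h₂.exists_isBase_inter_eq hB₂
    have := hX B₁ B₂ hB₁ hB₂
    convert this using 1
    rw [hBB₁]
    ext e
    have h3 : e ∈ B → e ∈ M.E := fun h => hBE h
    have h4 : e ∈ B₂ → e ∈ M.E := fun h => hB₂.subset_ground h
    have h5 := Set.ext_iff.1 hBB₂ e
    simp only [hE, mem_union, mem_inter_iff, mem_sdiff] at h5 ⊢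
    tauto

/-! ### Projections and sections of the base polytope -/

/-- The coordinate projection `ℝ^E(M) → ℝ^E(N)` when `E(N) ⊆ E(M)`. -/
def restrictCoords {M N : Matroid α} (hNM : N.E ⊆ M.E) : (M.E → ℝ) →ₗ[ℝ] (N.E → ℝ) :=
  LinearMap.funLeft ℝ ℝ fun e => ⟨e, hNM e.2⟩

theorem restrictCoords_apply {M N : Matroid α} (hNM : N.E ⊆ M.E) (x : M.E → ℝ) (e : N.E) :
    restrictCoords hNM x e = x ⟨e, hNM e.2⟩ := rfl

theorem IsRestriction.image_basePolytope {M N : Matroid α} (hN : N ≤r M)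
    (hX : ∀ B B', M.IsBase B → M.IsBase B' → M.IsBase (B ∩ N.E ∪ B' \ N.E)) :
    restrictCoords hN.subset '' M.basePolytope = N.basePolytope := by
  have hchar : ∀ B, restrictCoords hN.subset (M.charVec B) = N.charVec (B ∩ N.E) := by
    intro B
    ext e
    rw [restrictCoords_apply]
    by_cases he : (e : α) ∈ B
    · rw [charVec_apply_of_mem (by exact he), charVec_apply_of_mem (M := N) (B := B ∩ N.E) ⟨he, e.2⟩]
    · rw [charVec_apply_of_notMem (by exact he), charVec_apply_of_notMem fun h => he h.1]
  rw [basePolytope, LinearMap.image_convexHull, basePolytope]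
  congr 1
  ext x
  constructor
  · rintro ⟨_, ⟨B, hB, rfl⟩, rfl⟩
    exact ⟨_, hN.isBase_inter hX hB, hchar B⟩
  · rintro ⟨I, hI, rfl⟩
    obtain ⟨B, hB, rfl⟩ := hN.exists_isBase_inter_eq hI
    exact ⟨_, ⟨B, hB, rfl⟩, hchar B⟩

open Classical in
/-- The affine map `ℝ^E(N) → ℝ^E(M)` that fills in the coordinates outside `E(N)` from `y`. -/
noncomputable def fillCoords {M : Matroid α} (N : Matroid α) (y : M.E → ℝ) :
    (N.E → ℝ) →ᵃ[ℝ] (M.E → ℝ) where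
  toFun x e := if h : (e : α) ∈ N.E then x ⟨e, h⟩ else y e
  linear :=
    { toFun := fun x e => if h : (e : α) ∈ N.E then x ⟨e, h⟩ else 0
      map_add' := fun x x' => by ext e; by_cases h : (e : α) ∈ N.E <;> simp [h]
      map_smul' := fun c x => by ext e; by_cases h : (e : α) ∈ N.E <;> simp [h] }
  map_vadd' p q := by
    ext e
    by_cases h : (e : α) ∈ N.E <;> simp [h, LinearMap.coe_mk, AddHom.coe_mk]

theorem fillCoords_apply_of_mem {M N : Matroid α} (y : M.E → ℝ) (x : N.E → ℝ) {e : M.E}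
    (he : (e : α) ∈ N.E) : fillCoords N y x e = x ⟨e, he⟩ :=
  dif_pos he

theorem fillCoords_apply_of_notMem {M N : Matroid α} (y : M.E → ℝ) (x : N.E → ℝ) {e : M.E}
    (he : (e : α) ∉ N.E) : fillCoords N y x e = y e :=
  dif_neg he

section Product

variable {M : Matroid α} {X : Set α} {J₁ J₂ : Type*} {v : J₁ × J₂ → M.E → ℝ}

open Classical in
/-- A base polytope spanned by points indexed by a product, whose coordinates in `X` depend on the
first index only and whose other coordinates depend on the second index only, is closed under
exchanging the coordinates in `X`. -/
theorem ite_mem_basePolytope (hP : M.basePolytope = convexHull ℝ (range v))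
    (h₁ : ∀ e : M.E, (e : α) ∈ X → ∀ j₁ j₂ j₂', v (j₁, j₂) e = v (j₁, j₂') e)
    (h₂ : ∀ e : M.E, (e : α) ∉ X → ∀ j₁ j₁' j₂, v (j₁, j₂) e = v (j₁', j₂) e)
    {x y : M.E → ℝ} (hx : x ∈ M.basePolytope) (hy : y ∈ M.basePolytope) :
    (fun e : M.E => if (e : α) ∈ X then x e else y e) ∈ M.basePolytope := by
  have hconv : Convex ℝ M.basePolytope := convex_convexHull ℝ _
  -- Mixing is affine in each argument separately, so it suffices to check it on vertices, one
  -- argument at a time.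
  have hyc : ∀ x : M.E → ℝ,
      Convex ℝ {y : M.E → ℝ | (fun e : M.E => if (e : α) ∈ X then x e else y e) ∈ M.basePolytope} := by
    intro x y₁ hy y' hy' s t hs ht hst
    rw [mem_ofPred_eq]
    convert hconv hy hy' hs ht hst using 1
    ext e
    by_cases he : (e : α) ∈ X
    · simp [he, ← add_mul, hst]
    · simp [he]
  have hxc : ∀ y : M.E → ℝ,
      Convex ℝ {x : M.E → ℝ | (fun e : M.E => if (e : α) ∈ X then x e else y e) ∈ M.basePolytope} := by
    intro y x₁ hx x' hx' s t hs ht hst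
    rw [mem_ofPred_eq]
    convert hconv hx hx' hs ht hst using 1
    ext e
    by_cases he : (e : α) ∈ X
    · simp [he]
    · simp [he, ← add_mul, hst]
  rw [hP] at hx hy
  refine convexHull_min ?_ (hxc y) hx
  rintro _ ⟨⟨j₁, j₂⟩, rfl⟩
  refine convexHull_min ?_ (hyc _) hy
  rintro _ ⟨⟨j₁', j₂'⟩, rfl⟩
  rw [mem_ofPred_eq, hP]
  refine subset_convexHull ℝ _ ⟨(j₁, j₂'), ?_⟩
  ext e
  by_cases he : (e : α) ∈ X
  · simp only [he, if_true]; exact h₁ e he _ _ _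
  · simp only [he, if_false]; exact h₂ e he _ _ _

theorem isBase_exchange_of_product (hP : M.basePolytope = convexHull ℝ (range v))
    (h₁ : ∀ e : M.E, (e : α) ∈ X → ∀ j₁ j₂ j₂', v (j₁, j₂) e = v (j₁, j₂') e)
    (h₂ : ∀ e : M.E, (e : α) ∉ X → ∀ j₁ j₁' j₂, v (j₁, j₂) e = v (j₁', j₂) e)
    (B B' : Set α) (hB : M.IsBase B) (hB' : M.IsBase B') : M.IsBase (B ∩ X ∪ B' \ X) := by
  classical
  refine isBase_of_charVec_mem_basePolytope (union_subset (inter_subset_left.trans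
    hB.subset_ground) (sdiff_subset.trans hB'.subset_ground)) ?_
  convert ite_mem_basePolytope hP h₁ h₂ hB.charVec_mem_basePolytope
    hB'.charVec_mem_basePolytope using 1
  ext e
  by_cases he : (e : α) ∈ X <;> by_cases heB : (e : α) ∈ B <;> by_cases heB' : (e : α) ∈ B' <;>
    simp [charVec, he, heB, heB']

end Product

theorem IsRestriction.isNormalizedSlackMatrix {M N : Matroid α} (hN : N ≤r M)
    {R₁ R₂ J₁ J₂ : Type*} [Nonempty J₁] [Nonempty J₂]
    {S₁ : Matrix R₁ J₁ ℝ} {S₂ : Matrix R₂ J₂ ℝ} {v : J₁ × J₂ → M.E → ℝ}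
    {a : R₁ ⊕ R₂ → Module.Dual ℝ (M.E → ℝ)} {b : R₁ ⊕ R₂ → ℝ}
    (h : IsSlackMatrixWith M.basePolytope v a b (oneProduct S₁ S₂))
    (hloop : ∀ e, ¬ M.IsLoop e) (hcoloop : ∀ e, ¬ M.IsColoop e)
    (hconst : ∀ i, ¬ ∃ c : ℝ, ∀ j, S₁ i j = c)
    (hX : ∀ B B', M.IsBase B → M.IsBase B' → M.IsBase (B ∩ N.E ∪ B' \ N.E))
    (h₁ : ∀ e : M.E, (e : α) ∈ N.E → ∃ i, ∀ j, S₁ i j.1 = v j e)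
    (h₂ : ∀ e : M.E, (e : α) ∉ N.E → ∃ i, ∀ j, S₂ i j.2 = v j e) :
    N.IsNormalizedSlackMatrix S₁ := by
  obtain ⟨j₁⟩ := ‹Nonempty J₁›
  obtain ⟨j₂⟩ := ‹Nonempty J₂›
  -- Any vertex with second index `j₂` may fill in the missing coordinates, since those depend on
  -- `j₂` alone.
  have key := h.of_oneProduct (restrictCoords hN.subset) (fillCoords N (v (j₁, j₂)))
    (fun x => by
      ext e
      rw [restrictCoords_apply]
      exact fillCoords_apply_of_mem (M := M) (N := N) (e := ⟨e, hN.subset e.2⟩) _ _ e.2) j₂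
    (fun j => by
      ext e
      by_cases he : (e : α) ∈ N.E
      · rw [fillCoords_apply_of_mem _ _ he, restrictCoords_apply]
      · obtain ⟨i, hi⟩ := h₂ e he
        rw [fillCoords_apply_of_notMem _ _ he, ← hi, ← hi])
    (fun j j' => by
      ext e
      obtain ⟨i, hi⟩ := h₁ ⟨e, hN.subset e.2⟩ e.2
      rw [restrictCoords_apply, restrictCoords_apply, ← hi, ← hi])
  rw [hN.image_basePolytope hX] at key
  refine ⟨fun e he => hloop e (he.of_isRestriction hN), fun e he => ?_, hconst,
    _, _, _, key, fun e => ?_⟩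
  -- Restriction can create coloops in general; here it cannot, as every base of `M` meets `N.E` in
  -- a base of `N`.
  · rw [isColoop_iff_forall_mem_isBase] at he
    exact hcoloop e (isColoop_iff_forall_mem_isBase.2 fun B hB =>
      (he (hN.isBase_inter hX hB)).1)
  · obtain ⟨i, hi⟩ := h₁ ⟨e, hN.subset e.2⟩ e.2
    exact ⟨i, fun j => hi (j, j₂)⟩

theorem IsNormalizedSlackMatrix.isSlackMatrix {M : Matroid α} {R J : Type*} {S : Matrix R J ℝ}
    (h : M.IsNormalizedSlackMatrix S) : IsSlackMatrix M.basePolytope S := by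
  obtain ⟨-, -, -, v, a, b, h, -⟩ := h
  exact ⟨v, a, b, h⟩

end Matroid

theorem mainTheorem9 {α R J R₁ J₁ R₂ J₂ : Type*}
    [Finite R] [Finite J] [Finite R₁] [Finite J₁] [Finite R₂] [Finite J₂]
    [Nonempty R₁] [Nonempty J₁] [Nonempty R₂] [Nonempty J₂]
    (M : Matroid α) [M.Finite] (S : Matrix R J ℝ)
    (hS : M.IsNormalizedSlackMatrix S)
    (S₁ : Matrix R₁ J₁ ℝ) (S₂ : Matrix R₂ J₂ ℝ)
    (hprod : MatrixIsomorphic S (oneProduct S₁ S₂)) :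
    ∃ (M₁ M₂ : Matroid α) (hdisj : Disjoint M₁.E M₂.E),
      M₁.E.Nonempty ∧ M₂.E.Nonempty ∧ M = M₁.disjointSum M₂ hdisj ∧
      IsSlackMatrix M₁.basePolytope S₁ ∧ IsSlackMatrix M₂.basePolytope S₂ ∧
      M₁.IsNormalizedSlackMatrix S₁ ∧ M₂.IsNormalizedSlackMatrix S₂ := by
  obtain ⟨r, c, hrc⟩ := hprod
  obtain ⟨hloop, hcoloop, hconst, v, a, b, h, hrow⟩ := hS
  have hentry : ∀ i j, oneProduct S₁ S₂ i j = S (r.symm i) (c.symm j) := fun i j => by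
    rw [← hrc]; rfl
  have h' := h.relabel r.symm c.symm hentry
  set w := v ∘ c.symm
  set a' := a ∘ r.symm
  set b' := b ∘ r.symm
  have hrow' : ∀ e : M.E, ∃ i, ∀ j, oneProduct S₁ S₂ i j = w j e := fun e => by
    obtain ⟨i, hi⟩ := hrow e
    exact ⟨r i, fun j => by simp [hentry, hi, w]⟩
  have hconst' : ∀ i, ¬ ∃ c : ℝ, ∀ j, oneProduct S₁ S₂ i j = c := fun i ⟨d, hd⟩ =>
    hconst (r.symm i) ⟨d, fun j => by simpa [hentry] using hd (c j)⟩
  have hconst₁ : ∀ i, ¬ ∃ c : ℝ, ∀ j, S₁ i j = c := fun i ⟨d, hd⟩ =>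
    hconst' (Sum.inl i) ⟨d, fun j => hd j.1⟩
  have hconst₂ : ∀ i, ¬ ∃ c : ℝ, ∀ j, S₂ i j = c := fun i ⟨d, hd⟩ =>
    hconst' (Sum.inr i) ⟨d, fun j => hd j.2⟩
  let X : Set α := {e | ∃ he : e ∈ M.E, ∃ i, ∀ j, S₁ i j.1 = w j ⟨e, he⟩}
  have hXE : X ⊆ M.E := fun e he => he.1
  have h₁ : ∀ e : M.E, (e : α) ∈ X → ∃ i, ∀ j, S₁ i j.1 = w j e := fun e he => he.2
  have h₂ : ∀ e : M.E, (e : α) ∉ X → ∃ i, ∀ j, S₂ i j.2 = w j e := fun e he => by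
    obtain ⟨i | i, hi⟩ := hrow' e
    · exact absurd ⟨e.2, i, hi⟩ he
    · exact ⟨i, hi⟩
  have hX := Matroid.isBase_exchange_of_product (M := M) (X := X) h'.eq_convexHull
    (fun e he j₁ j₂ j₂' => by obtain ⟨i, hi⟩ := h₁ e he; rw [← hi, ← hi])
    (fun e he j₁ j₁' j₂ => by obtain ⟨i, hi⟩ := h₂ e he; rw [← hi, ← hi])
  have h'' : IsSlackMatrixWith M.basePolytope (w ∘ Equiv.prodComm J₂ J₁)
      (a' ∘ Equiv.sumComm R₂ R₁) (b' ∘ Equiv.sumComm R₂ R₁) (oneProduct S₂ S₁) :=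
    h'.relabel _ _ fun i j => by rcases i with i | i <;> rfl
  have hN₁ := (Matroid.restrict_isRestriction M X hXE).isNormalizedSlackMatrix h' hloop hcoloop
    hconst₁ hX h₁ h₂
  have hN₂ := (Matroid.restrict_isRestriction M (M.E \ X) sdiff_subset).isNormalizedSlackMatrix h''
    hloop hcoloop hconst₂ (Matroid.exchange_compl hX)
    (fun e he => by obtain ⟨i, hi⟩ := h₂ e he.2; exact ⟨i, fun j => hi j.swap⟩)
    (fun e he => by
      obtain ⟨i, hi⟩ := h₁ e (by_contra fun heX => he ⟨e.2, heX⟩)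
      exact ⟨i, fun j => hi j.swap⟩)
  refine ⟨M.restrict X, M.restrict (M.E \ X), disjoint_sdiff_right, ?_, ?_,
    Matroid.eq_disjointSum_of_isRestriction (Matroid.restrict_isRestriction M X hXE)
      (Matroid.restrict_isRestriction M (M.E \ X) sdiff_subset) _ rfl hX,
    hN₁.isSlackMatrix, hN₂.isSlackMatrix, hN₁, hN₂⟩
  -- If `X` were empty, no point would depend on its first index, so the rows of `S₁` would be
  -- constant.
  · by_contra hne
    obtain ⟨i⟩ := ‹Nonempty R₁›
    obtain ⟨j₂⟩ := ‹Nonempty J₂›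
    obtain ⟨j₁⟩ := ‹Nonempty J₁›
    refine hconst₁ i ⟨S₁ i j₁, fun j => ?_⟩
    have hw : w (j, j₂) = w (j₁, j₂) := by
      ext e
      obtain ⟨k, hk⟩ := h₂ e fun he => hne ⟨e, he⟩
      rw [← hk, ← hk]
    exact (h'.slack_eq (Sum.inl i) (j, j₂)).trans
      ((congrArg _ (congrArg _ hw)).trans (h'.slack_eq (Sum.inl i) (j₁, j₂)).symm)
  · by_contra hne
    obtain ⟨i⟩ := ‹Nonempty R₂›
    obtain ⟨j₂⟩ := ‹Nonempty J₂›
    obtain ⟨j₁⟩ := ‹Nonempty J₁›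
    refine hconst₂ i ⟨S₂ i j₂, fun j => ?_⟩
    have hw : w (j₁, j) = w (j₁, j₂) := by
      ext e
      obtain ⟨k, hk⟩ := h₁ e (by_contra fun he => hne ⟨e, e.2, he⟩)
      rw [← hk, ← hk]
    exact (h'.slack_eq (Sum.inr i) (j₁, j)).trans
      ((congrArg _ (congrArg _ hw)).trans (h'.slack_eq (Sum.inr i) (j₁, j₂)).symm)
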